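/- **Theorem.** Let $K$ users with powers $p_1,\dots,p_K>0$ transmit over the real, symbol-synchronous multi-code CDMA channel with processing gain $N\ge 1$ and Gaussian noise of variance $\sigma^2>0$ per dimension, where user $k$ may use at most $\bar n_k\ge 1$ signature sequences, and let the users be numbered so that $p_1/\bar n_1\ge\cdots\ge p_K/\bar n_K$. All logarithms have base $2$. The maximum sum rate of this system (in bits per chip) is $$\mathcal C_{\rm CDMA}(p,\bar n,N,\sigma^2)=\max_{P,S}\ \frac1{2N}\log\det\Big(I_N+\frac1{\sigma^2}SPS^T\Big),$$ over $S=[S_1,\dots,S_K]$ with $S_k\in\mathbb R^{N\times\bar n_k}$ and $P=\mathrm{diag}(P_1,\dots,P_K)$ with $P_k\in\mathbb R^{\bar n_k\times\bar n_k}$ positive semidefinite, subject to $\frac1N\mathrm{tr}(S_kP_kS_k^T)=p_k$ for all $k$. The maximum is attained, and it does not change if $P_k$ is required to be a power split $P_k=\mathrm{diag}(p_{k,1},\dots,p_{k,\bar n_k})$ with $p_{k,l}\ge 0$, $\sum_l p_{k,l}=p_k$, and every column of $S$ to have squared Euclidean norm $N$. For bandwidth limits $\bar w_k$, total bandwidth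 $w_{\rm tot}$ and one-sided noise power spectral density $N_0$, the maximum sum rate of the restricted FDMA system is $$\mathcal C_{\rm FDMA}(p,\bar w,w_{\rm tot},N_0)=\max\Big\{\sum_{k=1}^K w_k\log\Big(1+\frac{p_k}{N_0w_k}\Big):\ 0\le w_k\le\bar w_k\ \forall k,\ \sum_{k=1}^K w_k\le w_{\rm tot}\Big\},$$ where a term with $w_k=0$ is $0$. Put $$\hat n_k=\Big(N-\sum_{k'=1}^{k-1}\bar n_{k'}\Big)\frac{p_k}{\sum_{k'=k}^Kp_{k'}}.$$ User $k$ is called oversized if $\hat n_k>\bar n_k$ and undersized if $\hat n_k<\bar n_k$. Let $K_1$ be the number of oversized users and $K_2$ the number of users that are not undersized. Then $\mathcal C_{\rm FDMA}\big(p,\frac{\bar n}{2N},\frac12,2\sigma^2\big)$ is attained and $$\mathcal C_{\rm CDMA}(p,\bar n,N,\sigma^2)=\mathcal C_{\rm FDMA}\Big(p,\frac{\bar n}{2N},\frac12,2\sigma^2\Big)=R(K_1)=R(K_2),$$ where $$R(m)=\sum_{k=1}^{m}\frac{\bar n_k}{2N}\log\Big(1+\frac{Np_k}{\sigma^2\bar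 n_k}\Big)+\frac{N-\sum_{k=1}^{m}\bar n_k}{2N}\log\Big(1+\frac{N\sum_{k=m+1}^{K}p_k}{\sigma^2\big(N-\sum_{k=1}^{m}\bar n_k\big)}\Big),$$ and the second term of $R(m)$ is $0$ if $N=\sum_{k=1}^{m}\bar n_k$. -/

import Mathlib

/-!
Multi-code CDMA and restricted FDMA: users are indexed by `Fin K`, all logarithms have base 2.
-/

namespace MultiCodeCDMA

/-- Index set of the signature sequences: user `k` owns the streams `(k, l)` with `l < n k`. -/
abbrev Stream {K : ℕ} (n : Fin K → ℕ) : Type := (k : Fin K) × Fin (n k)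

/-- The sum rate `(1 / (2N)) log₂ det (I_N + (1 / σ²) S P Sᵀ)` in bits per chip of the synchronous
system with processing gain `N`, noise variance `σ²`, signature-sequence matrix `S` and
data-correlation matrix `P`. -/
noncomputable def sumRate {K : ℕ} {n : Fin K → ℕ} {N : ℕ} (σ : ℝ)
    (S : Matrix (Fin N) (Stream n) ℝ) (P : Matrix (Stream n) (Stream n) ℝ) : ℝ :=
  1 / (2 * (N : ℝ)) *
    Real.logb 2 (1 + (1 / σ ^ 2) • (S * P * S.transpose) : Matrix (Fin N) (Fin N) ℝ).det

/-- The horizontal concatenation `[S₁, …, S_K]` of the users' signature-sequence matrices. -/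
def concat {K : ℕ} {n : Fin K → ℕ} {N : ℕ} (S : (k : Fin K) → Matrix (Fin N) (Fin (n k)) ℝ) :
    Matrix (Fin N) (Stream n) ℝ :=
  Matrix.of fun i j => S j.1 i j.2

/-- The sum rates of the multi-code CDMA system: user `k` has an arbitrary signature-sequence matrix
`S k` with `n k` columns (streams that are not used have zero power) and an arbitrary correlation
matrix `P k` of its data symbols, under the power constraint `(1 / N) tr (S k * P k * (S k)ᵀ) = p k`;
data of different users are independent, so `P` is block diagonal. -/
def cdmaSumRates {K : ℕ} (p : Fin K → ℝ) (n : Fin K → ℕ) (N : ℕ) (σ : ℝ) : Set ℝ :=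
  {r | ∃ (S : (k : Fin K) → Matrix (Fin N) (Fin (n k)) ℝ)
         (P : (k : Fin K) → Matrix (Fin (n k)) (Fin (n k)) ℝ),
      (∀ k, (P k).PosSemidef) ∧
      (∀ k, 1 / (N : ℝ) * (S k * P k * (S k).transpose).trace = p k) ∧
      r = sumRate σ (concat S) (Matrix.blockDiagonal' P)}

/-- The sum rates of the multi-code CDMA system over power splits `q k l ≥ 0`, `∑ l, q k l = p k`
(uncorrelated data streams), and signature sequences of squared Euclidean norm `N`. -/
def cdmaSplitSumRates {K : ℕ} (p : Fin K → ℝ) (n : Fin K → ℕ) (N : ℕ) (σ : ℝ) : Set ℝ :=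
  {r | ∃ (S : Matrix (Fin N) (Stream n) ℝ) (q : (k : Fin K) → Fin (n k) → ℝ),
      (∀ j, ∑ i, S i j ^ 2 = (N : ℝ)) ∧
      (∀ k l, 0 ≤ q k l) ∧
      (∀ k, ∑ l, q k l = p k) ∧
      r = sumRate σ S (Matrix.diagonal fun j => q j.1 j.2)}

/-- The maximum sum rate of the multi-code CDMA system with power profile `p`, upper limits `n` on
the numbers of signature sequences, processing gain `N` and noise variance `σ²` per dimension. -/
noncomputable def cdmaMaxSumRate {K : ℕ} (p : Fin K → ℝ) (n : Fin K → ℕ) (N : ℕ) (σ : ℝ) : ℝ :=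
  sSup (cdmaSumRates p n N σ)

/-- The sum rates `∑ₖ wₖ log₂ (1 + pₖ / (N₀ wₖ))` of the restricted FDMA system over the bandwidth
allocations with `0 ≤ wₖ ≤ wbarₖ` and `∑ₖ wₖ ≤ wtot`; a term with `wₖ = 0` is zero, as division by
zero is multiplied by zero here. -/
def fdmaSumRates {K : ℕ} (p wbar : Fin K → ℝ) (wtot N₀ : ℝ) : Set ℝ :=
  {r | ∃ w : Fin K → ℝ, (∀ k, 0 ≤ w k ∧ w k ≤ wbar k) ∧ ∑ k, w k ≤ wtot ∧
      r = ∑ k, w k * Real.logb 2 (1 + p k / (N₀ * w k))}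

/-- The maximum sum rate of the restricted FDMA system with power profile `p`, bandwidth limits
`wbar`, total bandwidth `wtot` and one-sided noise PSD `N₀`. -/
noncomputable def fdmaMaxSumRate {K : ℕ} (p wbar : Fin K → ℝ) (wtot N₀ : ℝ) : ℝ :=
  sSup (fdmaSumRates p wbar wtot N₀)

/-- The due share `n̂ₖ = (N - ∑_{k' < k} n_{k'}) pₖ / ∑_{k' ≥ k} p_{k'}` of user `k`. -/
noncomputable def dueShare {K : ℕ} (p : Fin K → ℝ) (n : Fin K → ℕ) (N : ℕ) (k : Fin K) : ℝ :=
  ((N : ℝ) - ∑ k' ∈ Finset.Iio k, (n k' : ℝ)) * (p k / ∑ k' ∈ Finset.Ici k, p k')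

/-- User `k` is oversized. -/
def Oversized {K : ℕ} (p : Fin K → ℝ) (n : Fin K → ℕ) (N : ℕ) (k : Fin K) : Prop :=
  (n k : ℝ) < dueShare p n N k

/-- User `k` is undersized (a user that is neither oversized nor undersized is critically-sized). -/
def Undersized {K : ℕ} (p : Fin K → ℝ) (n : Fin K → ℕ) (N : ℕ) (k : Fin K) : Prop :=
  dueShare p n N k < (n k : ℝ)

/-- `K₁`, the number of oversized users. -/
noncomputable def numOversized {K : ℕ} (p : Fin K → ℝ) (n : Fin K → ℕ) (N : ℕ) : ℕ :=
  Set.ncard {k : Fin K | Oversized p n N k}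

/-- `K₂`, the number of non-undersized users. -/
noncomputable def numNonUndersized {K : ℕ} (p : Fin K → ℝ) (n : Fin K → ℕ) (N : ℕ) : ℕ :=
  Set.ncard {k : Fin K | ¬ Undersized p n N k}

/-- The closed form of the maximum sum rate in which the first `m` users get their upper limits and
the remaining users share what is left. -/
noncomputable def closedForm {K : ℕ} (p : Fin K → ℝ) (n : Fin K → ℕ) (N : ℕ) (σ : ℝ) (m : ℕ) : ℝ :=
  ∑ k : Fin K with k.val < m,
      (n k : ℝ) / (2 * N) * Real.logb 2 (1 + N * p k / (σ ^ 2 * n k)) +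
    (N - ∑ k : Fin K with k.val < m, (n k : ℝ)) / (2 * N) *
      Real.logb 2 (1 + N * (∑ k : Fin K with m ≤ k.val, p k) /
        (σ ^ 2 * (N - ∑ k : Fin K with k.val < m, (n k : ℝ))))

end MultiCodeCDMA

/-!
# The maximum sum rate of multi-code CDMA

Write `γ = N / σ²` and say that the power per dimension of user `k` is `p k / n k` when the user is
held to its limit. The proof rests on the notion of a threshold `m` (`IsThreshold`): the first `m`
users, at their limits, have at least the power per dimension
`c = (∑_{k ≥ m} p k) / (N - ∑_{k < m} n k)` that the other users have when they share the remaining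
dimensions, and each of the others has `p k / n k ≤ c`, so that its limit does not keep it from
taking its proportional part of those dimensions. Since users are numbered by decreasing
`p k / n k`, the oversized users and the users that are not undersized are both initial segments, and
both end at a threshold. So it suffices to show that *at every threshold* the closed form is the maximum of all
three optimization problems; that the two closed forms agree is then a consequence.

*FDMA.* The function `(v, q) ↦ v log (1 + γ q / v)` is concave, and its tangents at the power levels
`p k / n k` (for `k < m`) and `c` (for `k ≥ m`) turn the problem into a linear program, whose optimum
is the allocation of the closed form because the marginal value of bandwidth grows with the power
level (`fdma_le`, `exists_fdma_eq`).

*CDMA, converse.* Gram–Schmidt, applied to the signatures of the first `m` users, gives an orthonormal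
basis of `ℝ^N` adapted to the flag of the ranges of `[S₁, …, S_k]`
(`exists_orthonormalBasis_of_levels`). The first `n 0` basis vectors get the level `p 0 / n 0`, the
next `n 1` the level `p 1 / n 1`, and so on, and the remaining ones get `c`. The tangent bound of
`log det` at the matrix that is diagonal in this basis with these levels (`log_det_le`) is linear in
the signal covariance. User `k < m` has no power along basis vectors of later users, hence all its
power lies where the level is at least `p k / n k` and the weight at most `1 / (1 + γ p k / n k)`;
the levels are nowhere below `c`. Summing over the users gives the closed form
(`sum_div_level_le`, `log_det_le_closedFormNat`).

*CDMA, achievability.* With equal power splits, the first `m` users get orthogonal signatures, and the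
streams of the others, of powers `p k / n k ≤ c`, form a tight frame of the remaining dimensions
(`exists_tight_frame`): there are matrices with orthogonal rows of equal norm and prescribed column
norms as soon as the squared norms have the same sum over rows and columns and no squared column norm
exceeds the squared row norm. Such a matrix is built column by column, at each step with at most one
row that is not of full norm (`exists_rows_of_sum_eq`).
-/

namespace MultiCodeCDMA

open Matrix

variable {K : ℕ} {p : Fin K → ℝ} {n : Fin K → ℕ} {N : ℕ} {σ : ℝ} {m M : ℕ}

/-! ### Tight frames, flags and the tangent bound of `log det` -/

/-- The induction step of `exists_rows_of_sum_eq` has to split one row of squared norm `y` into two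
rows of squared norms `x ≤ y` and `c ≥ y` by a rotation `(s, t)` and a new column `(v, w)`; these are
the numbers that make the two new rows orthogonal. -/
lemma exists_rotation {c x y : ℝ} (hx : 0 ≤ x) (hxc : x < c) (hxy : x ≤ y) (hyc : y ≤ c) :
    ∃ s t v w : ℝ, s ^ 2 + t ^ 2 = 1 ∧ v ^ 2 + s ^ 2 * y = x ∧ w ^ 2 + t ^ 2 * y = c ∧
      v * w + s * t * y = 0 := by
  have hcx : 0 < c - x := sub_pos.2 hxc
  have hc : 0 < c := hx.trans_lt hxc
  rcases (hx.trans hxy).eq_or_lt with hy | hy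
  · obtain rfl : x = 0 := le_antisymm (hy ▸ hxy) hx
    refine ⟨1, 0, 0, √c, ?_⟩
    simp [Real.sq_sqrt hc.le, ← hy]
  · have h1 : 0 ≤ x * (c - y) / (y * (c - x)) :=
      div_nonneg (mul_nonneg hx (sub_nonneg.2 hyc)) (by positivity)
    have h2 : 0 ≤ c * (y - x) / (y * (c - x)) :=
      div_nonneg (mul_nonneg hc.le (sub_nonneg.2 hxy)) (by positivity)
    have h3 : 0 ≤ x * (y - x) / (c - x) :=
      div_nonneg (mul_nonneg hx (sub_nonneg.2 hxy)) hcx.le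
    have h4 : 0 ≤ c * (c - y) / (c - x) :=
      div_nonneg (mul_nonneg hc.le (sub_nonneg.2 hyc)) hcx.le
    refine ⟨√(x * (c - y) / (y * (c - x))), √(c * (y - x) / (y * (c - x))),
      √(x * (y - x) / (c - x)), -√(c * (c - y) / (c - x)), ?_, ?_, ?_, ?_⟩
    · rw [Real.sq_sqrt h1, Real.sq_sqrt h2]
      field_simp
      ring
    · rw [Real.sq_sqrt h3, Real.sq_sqrt h1]
      field_simp
      ring
    · rw [neg_sq, Real.sq_sqrt h4, Real.sq_sqrt h2]
      field_simp
      ring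
    · rw [mul_neg, ← Real.sqrt_mul h3, ← Real.sqrt_mul h1]
      have : x * (c - y) / (y * (c - x)) * (c * (y - x) / (y * (c - x))) =
          x * (y - x) / (c - x) * (c * (c - y) / (c - x)) / y ^ 2 := by
        field_simp
      rw [this, Real.sqrt_div' _ (sq_nonneg y), Real.sqrt_sq hy.le]
      field_simp
      ring

/-- Tight frames with prescribed column norms, in a form fit for induction on the number of columns:
if `q` has entries in `[0, c]` and `∑ q = m c + x` with `0 ≤ x < c`, there are `m` rows of squared
norm `c` and one row of squared norm `x`, pairwise orthogonal, whose columns have squared norms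
`q`. -/
lemma exists_rows_of_sum_eq {c : ℝ} (hc : 0 < c) (d : ℕ) :
    ∀ (q : Fin d → ℝ) (m : ℕ) (x : ℝ), (∀ j, 0 ≤ q j) → (∀ j, q j ≤ c) → 0 ≤ x → x < c →
      ∑ j, q j = m * c + x →
      ∃ (r : Fin d → ℝ) (R : Fin m → Fin d → ℝ), r ⬝ᵥ r = x ∧ (∀ i, r ⬝ᵥ R i = 0) ∧
        (∀ i i', R i ⬝ᵥ R i' = if i = i' then c else 0) ∧
        ∀ j, r j ^ 2 + ∑ i, R i j ^ 2 = q j := by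
  induction d with
  | zero =>
    intro q m x _ _ hx _ hs
    have hmc : 0 ≤ (m : ℝ) * c := by positivity
    simp only [Finset.univ_eq_empty, Finset.sum_empty] at hs
    have hm : (m : ℝ) * c = 0 := by linarith
    obtain rfl : m = 0 := by simpa [hc.ne'] using hm
    exact ⟨0, 0, by simp; linarith, fun i => i.elim0, fun i => i.elim0, fun j => j.elim0⟩
  | succ d ih =>
    intro q m x hq hqc hx hxc hs
    rw [Fin.sum_univ_succ] at hs
    rcases le_or_gt (q 0) x with h | h
    · -- the first column only meets the short row
      obtain ⟨r, R, h1, h2, h3, h4⟩ := ih (fun j => q j.succ) m (x - q 0) (fun j => hq _)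
        (fun j => hqc _) (by linarith) (by linarith [hq 0]) (by linarith)
      refine ⟨vecCons (√(q 0)) r, fun i => vecCons 0 (R i), ?_, ?_, ?_, ?_⟩
      · simp [h1, Real.mul_self_sqrt (hq 0)]
      · simp [h2]
      · simp [h3]
      · intro j
        refine Fin.cases ?_ (fun j => ?_) j
        · simp [Real.sq_sqrt (hq 0)]
        · simpa using h4 j
    · -- the first column completes the short row to one of squared norm `c`
      obtain _ | m := m
      · have : 0 ≤ ∑ j : Fin d, q j.succ := Finset.sum_nonneg fun j _ => hq _
        norm_num at hs
        linarith
      push_cast at hs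
      obtain ⟨r, R, h1, h2, h3, h4⟩ := ih (fun j => q j.succ) m (c + x - q 0) (fun j => hq _)
        (fun j => hqc _) (by linarith [hqc 0]) (by linarith) (by linarith)
      obtain ⟨s, t, v, w, hst, hv, hw, hvw⟩ := exists_rotation (y := c + x - q 0) hx hxc
        (by linarith [hqc 0]) (by linarith)
      refine ⟨vecCons v (s • r), vecCons (vecCons w (t • r)) fun i => vecCons 0 (R i),
        ?_, ?_, ?_, ?_⟩
      · simp [h1]
        linarith
      · intro i
        refine Fin.cases ?_ (fun i => ?_) i
        · simp [h1]
          linarith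
        · simp [h2]
      · intro i i'
        refine Fin.cases ?_ (fun i => ?_) i <;> refine Fin.cases ?_ (fun i' => ?_) i'
        · simp [h1]
          linarith
        · simp [h2, (Fin.succ_ne_zero _).symm]
        · simp [dotProduct_comm _ r, h2]
        · simp [h3]
      · intro j
        refine Fin.cases ?_ (fun j => ?_) j
        · simp [Fin.sum_univ_succ]
          linear_combination hv + hw - (c + x - q 0) * hst
        · have := h4 j
          simp [Fin.sum_univ_succ]
          linear_combination this + r j ^ 2 * hst

/-- Existence of tight frames: `M` pairwise orthogonal rows of squared norm `c` can have columns of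
any prescribed squared norms `q ≤ c` of sum `M c`. -/
lemma exists_tight_frame {B : Type*} [Fintype B] (M : ℕ) {c : ℝ} (hc : 0 ≤ c) (q : B → ℝ)
    (hq : ∀ j, 0 ≤ q j) (hqc : ∀ j, q j ≤ c) (hs : ∑ j, q j = M * c) :
    ∃ V : Matrix (Fin M) B ℝ, V * Vᵀ = diagonal (fun _ => c) ∧ ∀ j, ∑ i, V i j ^ 2 = q j := by
  rcases hc.eq_or_lt with rfl | hc
  · refine ⟨0, by simp, fun j => ?_⟩
    simp [le_antisymm (hqc j) (hq j)]
  · let e := Fintype.equivFin B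
    obtain ⟨r, R, h1, -, h3, h4⟩ := exists_rows_of_sum_eq hc _ (fun j => q (e.symm j)) M 0
      (fun j => hq _) (fun j => hqc _) le_rfl hc (by rw [e.symm.sum_comp, hs, add_zero])
    rw [dotProduct_self_eq_zero] at h1
    subst h1
    refine ⟨of fun i j => R i (e j), ?_, fun j => by simpa using h4 (e j)⟩
    ext i i'
    rw [diagonal_apply, ← h3 i i', mul_apply]
    exact e.sum_comp fun j => R i j * R i' j

/-- A flag-adapted orthonormal basis: in an `N`-dimensional space, `N` vectors that carry levels have
an orthonormal basis whose elements are orthogonal to all vectors of lower level than their own. -/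
lemma exists_orthonormalBasis_of_levels {N : ℕ} (lev : Fin N → ℕ)
    (f : Fin N → EuclideanSpace ℝ (Fin N)) :
    ∃ b : OrthonormalBasis (Fin N) ℝ (EuclideanSpace ℝ (Fin N)),
      ∀ i j, lev j < lev i → inner ℝ (b i) (f j) = 0 := by
  have hcard : Module.finrank ℝ (EuclideanSpace ℝ (Fin N)) = Fintype.card (Fin N) := by simp
  let σ := Tuple.sort lev
  refine ⟨(InnerProductSpace.gramSchmidtOrthonormalBasis hcard (f ∘ σ)).reindex σ,
    fun i j hij => ?_⟩
  have hlt : σ.symm j < σ.symm i := by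
    by_contra! h
    have := Tuple.monotone_sort lev h
    simp only [Function.comp_apply] at this
    change lev (σ (σ.symm i)) ≤ lev (σ (σ.symm j)) at this
    rw [σ.apply_symm_apply, σ.apply_symm_apply] at this
    omega
  simpa using InnerProductSpace.gramSchmidtOrthonormalBasis_inv_triangular hcard (f ∘ σ) hlt

lemma log_one_add_le {x y : ℝ} (hx : 0 ≤ x) (hy : 0 ≤ y) :
    Real.log (1 + x) ≤ Real.log (1 + y) + (x - y) / (1 + y) := by
  have h := Real.log_le_sub_one_of_pos (x := (1 + x) / (1 + y)) (by positivity)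
  rw [Real.log_div (by positivity) (by positivity)] at h
  have : (1 + x) / (1 + y) - 1 = (x - y) / (1 + y) := by
    field_simp
    ring
  linarith

/-- The tangent bound of the concave function `log det` at the diagonal matrix with entries `d`. -/
lemma log_det_le {N : ℕ} {X : Matrix (Fin N) (Fin N) ℝ} (hX : X.PosDef) (d : Fin N → ℝ)
    (hd : ∀ i, 0 < d i) :
    Real.log X.det ≤ ∑ i, (Real.log (d i) + (X i i / d i - 1)) := by
  let D : Matrix (Fin N) (Fin N) ℝ := diagonal fun i => 1 / √(d i)
  have hDt : Dᴴ = D := by simp [D]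
  have hY : (D * X * D).PosDef := by
    have h := hX.mul_mul_conjTranspose_same (B := D) (by
      refine vecMul_injective_of_isUnit ?_
      rw [isUnit_iff_isUnit_det, det_diagonal, isUnit_iff_ne_zero, Finset.prod_ne_zero_iff]
      intro i _
      have := Real.sqrt_pos.2 (hd i)
      positivity)
    rwa [hDt] at h
  have hdet : (D * X * D).det = X.det / ∏ i, d i := by
    rw [det_mul, det_mul, mul_right_comm, det_diagonal, ← Finset.prod_mul_distrib]
    have : ∀ i, 1 / √(d i) * (1 / √(d i)) = (d i)⁻¹ := fun i => by
      rw [div_mul_div_comm, Real.mul_self_sqrt (hd i).le, one_mul, one_div]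
    simp_rw [this]
    rw [Finset.prod_inv_distrib]
    ring
  have htr : (D * X * D).trace = ∑ i, X i i / d i := by
    refine Finset.sum_congr rfl fun i _ => ?_
    rw [diag_apply, mul_diagonal, diagonal_mul]
    have := Real.sqrt_pos.2 (hd i)
    have := hd i
    field_simp
    rw [Real.sq_sqrt (hd i).le, mul_comm]
  have hev := hY.eigenvalues_pos
  have hlog : Real.log (D * X * D).det ≤ (D * X * D).trace - N := by
    rw [hY.1.det_eq_prod_eigenvalues, hY.1.trace_eq_sum_eigenvalues]
    simp only [RCLike.ofReal_real_eq_id, id_eq]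
    rw [Real.log_prod fun i _ => (hev i).ne']
    calc _ ≤ ∑ i, (hY.1.eigenvalues i - 1) :=
          Finset.sum_le_sum fun i _ => Real.log_le_sub_one_of_pos (hev i)
      _ = _ := by simp [Finset.sum_sub_distrib]
  rw [hdet, Real.log_div hX.det_pos.ne' (Finset.prod_ne_zero_iff.2 fun i _ => (hd i).ne'),
    Real.log_prod fun i _ => (hd i).ne', htr] at hlog
  simp only [Finset.sum_add_distrib, Finset.sum_sub_distrib, Finset.sum_const, Finset.card_univ,
    Fintype.card_fin, nsmul_eq_mul, mul_one]
  linarith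

/-! ### Thresholds -/

/-- The dimensions `N - ∑_{k < m} n_k` that are left when the first `m` users get their limits. -/
noncomputable def dimLeft (n : Fin K → ℕ) (N m : ℕ) : ℝ :=
  N - ∑ k : Fin K with k.val < m, (n k : ℝ)

/-- The total power of all but the first `m` users. -/
noncomputable def powerLeft (p : Fin K → ℝ) (m : ℕ) : ℝ :=
  ∑ k : Fin K with m ≤ k.val, p k

/-- `m` separates the users: compared with the power per dimension `powerLeft p m / dimLeft n N m`
of the remaining users, `p k / n k` is at least as large for `k < m` and at most as large for
`k ≥ m`. The inequalities are multiplied out, since `dimLeft n N m` may vanish. -/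
structure IsThreshold (p : Fin K → ℝ) (n : Fin K → ℕ) (N m : ℕ) : Prop where
  le_of_lt : ∀ k : Fin K, k.val < m → powerLeft p m * n k ≤ dimLeft n N m * p k
  le_of_ge : ∀ k : Fin K, m ≤ k.val → dimLeft n N m * p k ≤ powerLeft p m * n k
  le_card : m ≤ K

lemma sum_split (m : ℕ) (f : Fin K → ℝ) :
    ∑ k, f k = ∑ k : Fin K with k.val < m, f k + ∑ k : Fin K with m ≤ k.val, f k := by
  rw [← Finset.sum_filter_add_sum_filter_not _ (fun k : Fin K => k.val < m)]
  simp only [not_lt]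

lemma powerLeft_nonneg (hp : ∀ k, 0 < p k) : 0 ≤ powerLeft p m :=
  Finset.sum_nonneg fun k _ => (hp k).le

lemma powerLeft_pos (hp : ∀ k, 0 < p k) (k : Fin K) (hk : m ≤ k.val) : 0 < powerLeft p m :=
  Finset.sum_pos (fun k _ => hp k) ⟨k, by simpa using hk⟩

lemma dimLeft_zero : dimLeft n N 0 = N := by simp [dimLeft]

lemma sum_Iio_eq (k : Fin K) : (N : ℝ) - ∑ k' ∈ Finset.Iio k, (n k' : ℝ) = dimLeft n N k := by
  rw [dimLeft]
  congr 2
  ext j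
  simp

lemma sum_Ici_eq (k : Fin K) : ∑ k' ∈ Finset.Ici k, p k' = powerLeft p k := by
  rw [powerLeft]
  congr 1
  ext j
  simp

lemma dimLeft_succ (k : Fin K) : dimLeft n N k = dimLeft n N (k + 1) + n k := by
  have : (Finset.univ.filter fun j : Fin K => j.val < k.val + 1) =
      insert k (Finset.univ.filter fun j : Fin K => j.val < k.val) := by
    ext j
    simp only [Finset.mem_filter_univ, Finset.mem_insert, Fin.ext_iff]
    omega
  rw [dimLeft, dimLeft, this, Finset.sum_insert (by simp)]
  ring

lemma powerLeft_succ (k : Fin K) : powerLeft p k = p k + powerLeft p (k + 1) := by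
  have : (Finset.univ.filter fun j : Fin K => k.val ≤ j.val) =
      insert k (Finset.univ.filter fun j : Fin K => k.val + 1 ≤ j.val) := by
    ext j
    simp only [Finset.mem_filter_univ, Finset.mem_insert, Fin.ext_iff]
    omega
  rw [powerLeft, powerLeft, this, Finset.sum_insert (by simp)]

lemma dueShare_eq (k : Fin K) :
    dueShare p n N k = dimLeft n N k * p k / powerLeft p k := by
  rw [dueShare, sum_Iio_eq, sum_Ici_eq, mul_div_assoc]

/-- A user is at least critically-sized iff its power per stream is at least that left for the later
users. -/
lemma le_dueShare_iff (hp : ∀ k, 0 < p k) (k : Fin K) :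
    (n k : ℝ) ≤ dueShare p n N k ↔ powerLeft p (k + 1) * n k ≤ dimLeft n N (k + 1) * p k := by
  rw [dueShare_eq, le_div_iff₀ (powerLeft_pos hp k le_rfl), dimLeft_succ, powerLeft_succ]
  constructor <;> intro h <;> linarith

lemma lt_dueShare_iff (hp : ∀ k, 0 < p k) (k : Fin K) :
    (n k : ℝ) < dueShare p n N k ↔ powerLeft p (k + 1) * n k < dimLeft n N (k + 1) * p k := by
  rw [dueShare_eq, lt_div_iff₀ (powerLeft_pos hp k le_rfl), dimLeft_succ, powerLeft_succ]
  constructor <;> intro h <;> linarith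

lemma dueShare_le_iff (hp : ∀ k, 0 < p k) (k : Fin K) :
    dueShare p n N k ≤ n k ↔ dimLeft n N k * p k ≤ powerLeft p k * n k := by
  rw [dueShare_eq, div_le_iff₀ (powerLeft_pos hp k le_rfl), mul_comm (n k : ℝ)]

lemma lt_dueShare_iff' (hp : ∀ k, 0 < p k) (k : Fin K) :
    (n k : ℝ) < dueShare p n N k ↔ powerLeft p k * n k < dimLeft n N k * p k := by
  rw [← not_le, dueShare_le_iff hp, not_le]

lemma le_dueShare_iff' (hp : ∀ k, 0 < p k) (k : Fin K) :
    (n k : ℝ) ≤ dueShare p n N k ↔ powerLeft p k * n k ≤ dimLeft n N k * p k := by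
  rw [dueShare_eq, le_div_iff₀ (powerLeft_pos hp k le_rfl), mul_comm (n k : ℝ)]

/-- The numbering by decreasing power per stream, multiplied out. -/
lemma mul_le_mul_of_order (hn : ∀ k, 0 < n k)
    (hord : ∀ i j : Fin K, i ≤ j → p j / (n j : ℝ) ≤ p i / (n i : ℝ)) {i j : Fin K} (h : i ≤ j) :
    p j * n i ≤ p i * n j := by
  have hi : (0 : ℝ) < n i := by exact_mod_cast hn i
  have hj : (0 : ℝ) < n j := by exact_mod_cast hn j
  exact (div_le_div_iff₀ hj hi).1 (hord i j h)

/-- An initial segment of users with at least critically-sized members and at most critically-sized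
non-members ends at a threshold. -/
lemma isThreshold_of_dueShare (hp : ∀ k, 0 < p k) (hn : ∀ k, 0 < n k)
    (hord : ∀ i j : Fin K, i ≤ j → p j / (n j : ℝ) ≤ p i / (n i : ℝ)) (hm : m ≤ K)
    (hlt : ∀ k : Fin K, k.val < m → (n k : ℝ) ≤ dueShare p n N k)
    (hge : ∀ k : Fin K, m ≤ k.val → dueShare p n N k ≤ n k) : IsThreshold p n N m := by
  have hn' : ∀ k, (0 : ℝ) < n k := fun k => by exact_mod_cast hn k
  have hP : 0 ≤ powerLeft p m := powerLeft_nonneg hp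
  have key : ∀ k : Fin K, k.val < m → powerLeft p m * n k ≤ dimLeft n N m * p k := by
    intro k hk
    obtain ⟨l, rfl⟩ : ∃ l, m = l + 1 := ⟨m - 1, by omega⟩
    have h := (le_dueShare_iff hp _).1 (hlt ⟨l, hm⟩ (Nat.lt_succ_self l))
    dsimp only at h
    have ho := mul_le_mul_of_order hn hord (show k ≤ ⟨l, hm⟩ from Nat.lt_succ_iff.1 hk)
    have h1 := mul_le_mul_of_nonneg_right h (hp k).le
    have h2 := mul_le_mul_of_nonneg_left ho hP
    have := hp ⟨l, hm⟩
    refine le_of_mul_le_mul_right ?_ this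
    linarith
  have hM : 0 ≤ dimLeft n N m := by
    rcases m.eq_zero_or_pos with rfl | h0
    · rw [dimLeft_zero]
      positivity
    · have h1 := key ⟨0, by omega⟩ h0
      have h2 := mul_nonneg hP (hn' ⟨0, by omega⟩).le
      exact nonneg_of_mul_nonneg_left (h2.trans h1) (hp _)
  refine ⟨key, fun k hk => ?_, hm⟩
  have hmK : m < K := hk.trans_lt k.isLt
  have h := (dueShare_le_iff hp _).1 (hge ⟨m, hmK⟩ le_rfl)
  dsimp only at h
  have ho := mul_le_mul_of_order hn hord (show ⟨m, hmK⟩ ≤ k from hk)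
  have h1 := mul_le_mul_of_nonneg_right h (hn' k).le
  have h2 := mul_le_mul_of_nonneg_left ho hM
  refine le_of_mul_le_mul_right ?_ (hn' ⟨m, hmK⟩)
  linarith

lemma mem_iff_lt_ncard {s : Set (Fin K)} (hs : ∀ i j, i ≤ j → j ∈ s → i ∈ s) (k : Fin K) :
    k ∈ s ↔ k.val < s.ncard := by
  constructor
  · intro hk
    have : Set.Iic k ⊆ s := fun i hi => hs i k hi hk
    have h := Set.ncard_le_ncard this
    rw [Set.ncard_eq_toFinset_card', Set.toFinset_Iic, Fin.card_Iic] at h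
    omega
  · intro hk
    by_contra hks
    have : s ⊆ Set.Iio k := fun i hi => not_le.1 fun h => hks (hs k i h hi)
    have h := Set.ncard_le_ncard this
    rw [Set.ncard_eq_toFinset_card' (Set.Iio k), Set.toFinset_Iio, Fin.card_Iio] at h
    omega

lemma ncard_le_card (s : Set (Fin K)) : s.ncard ≤ K := by
  simpa using Set.ncard_le_card s

section order

variable (hp : ∀ k, 0 < p k) (hn : ∀ k, 0 < n k)
  (hord : ∀ i j : Fin K, i ≤ j → p j / (n j : ℝ) ≤ p i / (n i : ℝ))
include hp hn hord

/-- If the next user is not undersized, neither is this one, since it has at least as much power per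
stream. -/
lemma le_dueShare_of_succ {k l : Fin K} (hkl : l.val = k.val + 1)
    (h : (n l : ℝ) ≤ dueShare p n N l) : (n k : ℝ) ≤ dueShare p n N k := by
  have hn' : (0 : ℝ) < n l := by exact_mod_cast hn l
  rw [le_dueShare_iff' hp, hkl] at h
  rw [le_dueShare_iff hp]
  have ho := mul_le_mul_of_order hn hord (show k ≤ l from Fin.le_def.2 (by omega))
  have h1 := mul_le_mul_of_nonneg_right h (hp k).le
  have h2 := mul_le_mul_of_nonneg_left ho (powerLeft_nonneg hp (m := k.val + 1))
  refine le_of_mul_le_mul_right ?_ (hp l)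
  linarith

lemma lt_dueShare_of_succ {k l : Fin K} (hkl : l.val = k.val + 1)
    (h : (n l : ℝ) < dueShare p n N l) : (n k : ℝ) < dueShare p n N k := by
  have hn' : (0 : ℝ) < n l := by exact_mod_cast hn l
  rw [lt_dueShare_iff' hp, hkl] at h
  rw [lt_dueShare_iff hp]
  have ho := mul_le_mul_of_order hn hord (show k ≤ l from Fin.le_def.2 (by omega))
  have h1 := mul_lt_mul_of_pos_right h (hp k)
  have h2 := mul_le_mul_of_nonneg_left ho (powerLeft_nonneg hp (m := k.val + 1))
  refine lt_of_mul_lt_mul_right ?_ (hp l).le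
  linarith

omit hp hn hord in
lemma of_le_of_succ {Q : Fin K → Prop}
    (hQ : ∀ k l : Fin K, l.val = k.val + 1 → Q l → Q k) (i j : Fin K) (hij : i ≤ j) (hj : Q j) :
    Q i := by
  obtain ⟨d, hd⟩ : ∃ d, j.val = i.val + d := ⟨j - i, by have := Fin.le_def.1 hij; omega⟩
  induction d generalizing i with
  | zero => rwa [show i = j from Fin.ext (by omega)]
  | succ d ih =>
    have hi : i.val + 1 < K := by omega
    exact hQ i ⟨i + 1, hi⟩ rfl (ih _ (Fin.le_def.2 (by simp; omega)) (by simp; omega))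

lemma isThreshold_numOversized : IsThreshold p n N (numOversized p n N) := by
  have hs : ∀ k : Fin K, Oversized p n N k ↔ k.val < numOversized p n N :=
    mem_iff_lt_ncard (s := {k | Oversized p n N k})
      (of_le_of_succ (Q := Oversized p n N) fun k l => lt_dueShare_of_succ hp hn hord)
  exact isThreshold_of_dueShare hp hn hord (ncard_le_card _)
    (fun k hk => ((hs k).2 hk).le) (fun k hk => not_lt.1 fun h => (((hs k).1 h).not_ge) hk)

lemma isThreshold_numNonUndersized : IsThreshold p n N (numNonUndersized p n N) := by
  have hs : ∀ k : Fin K, ¬ Undersized p n N k ↔ k.val < numNonUndersized p n N :=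
    mem_iff_lt_ncard (s := {k | ¬ Undersized p n N k})
      (of_le_of_succ (Q := fun k => ¬ Undersized p n N k) fun k l hkl h =>
        not_lt.2 (le_dueShare_of_succ hp hn hord hkl (not_lt.1 h)))
  refine isThreshold_of_dueShare hp hn hord (ncard_le_card _)
    (fun k hk => not_lt.1 ((hs k).2 hk)) (fun k hk => ?_)
  by_contra! h
  exact ((hs k).1 (not_lt.2 h.le)).not_ge hk

end order

namespace IsThreshold

variable (h : IsThreshold p n N m) (hp : ∀ k, 0 < p k) (hn : ∀ k, 0 < n k)
include h hp

lemma dimLeft_nonneg : 0 ≤ dimLeft n N m := by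
  rcases m.eq_zero_or_pos with rfl | h0
  · rw [dimLeft_zero]
    positivity
  · have h1 := h.le_of_lt ⟨0, by have := h.le_card; omega⟩ h0
    have h2 := mul_nonneg (powerLeft_nonneg hp (m := m))
      (Nat.cast_nonneg (n ⟨0, by have := h.le_card; omega⟩))
    exact nonneg_of_mul_nonneg_left (h2.trans h1) (hp _)

lemma ratio_nonneg : 0 ≤ powerLeft p m / dimLeft n N m :=
  div_nonneg (powerLeft_nonneg hp) (h.dimLeft_nonneg hp)

include hn

lemma powerLeft_eq_zero (hN : 0 < N) (h0 : dimLeft n N m = 0) : powerLeft p m = 0 := by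
  rcases m.eq_zero_or_pos with rfl | hm
  · rw [dimLeft_zero] at h0
    exact absurd h0 (by positivity)
  · have h1 := h.le_of_lt ⟨0, by have := h.le_card; omega⟩ hm
    rw [h0, zero_mul] at h1
    have : (0 : ℝ) < n ⟨0, by have := h.le_card; omega⟩ := by exact_mod_cast hn _
    exact le_antisymm (nonpos_of_mul_nonpos_left h1 this) (powerLeft_nonneg hp)

lemma dimLeft_pos (hN : 0 < N) {k : Fin K} (hk : m ≤ k.val) : 0 < dimLeft n N m :=
  (h.dimLeft_nonneg hp).lt_of_ne' fun h0 =>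
    (powerLeft_pos hp k hk).ne' (h.powerLeft_eq_zero hp hn hN h0)

/-- The power per dimension left for the remaining users is a lower bound on the power per stream of
the first `m` users. -/
lemma ratio_le {k : Fin K} (hk : k.val < m) :
    powerLeft p m / dimLeft n N m ≤ p k / n k := by
  have hn' : (0 : ℝ) < n k := by exact_mod_cast hn k
  rcases (h.dimLeft_nonneg hp).eq_or_lt with h0 | h0
  · rw [← h0, div_zero]
    exact (div_pos (hp k) hn').le
  · rw [div_le_div_iff₀ h0 hn', mul_comm (p k)]
    exact h.le_of_lt k hk

lemma le_ratio (hN : 0 < N) {k : Fin K} (hk : m ≤ k.val) :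
    p k / n k ≤ powerLeft p m / dimLeft n N m := by
  have hn' : (0 : ℝ) < n k := by exact_mod_cast hn k
  rw [div_le_div_iff₀ hn' (h.dimLeft_pos hp hn hN hk), mul_comm (p k)]
  exact h.le_of_ge k hk

end IsThreshold

/-! ### The restricted FDMA system -/

/-- `closedForm` in nats and without the factor `1 / (2N)`, as a function of the signal-to-noise
ratio `γ = N / σ ^ 2` of a unit power per dimension. -/
noncomputable def closedFormNat (p : Fin K → ℝ) (n : Fin K → ℕ) (N m : ℕ) (γ : ℝ) : ℝ :=
  ∑ k : Fin K with k.val < m, n k * Real.log (1 + γ * (p k / n k)) +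
    dimLeft n N m * Real.log (1 + γ * (powerLeft p m / dimLeft n N m))

lemma closedForm_eq : closedForm p n N σ m =
    1 / (2 * (N : ℝ)) * (closedFormNat p n N m (N / σ ^ 2) / Real.log 2) := by
  have h (a b : ℝ) : (N : ℝ) / σ ^ 2 * (a / b) = N * a / (σ ^ 2 * b) := by
    rw [div_mul_div_comm]
  have hd : closedForm p n N σ m = ∑ k : Fin K with k.val < m,
      (n k : ℝ) / (2 * N) * Real.logb 2 (1 + N * p k / (σ ^ 2 * n k)) +
      dimLeft n N m / (2 * N) *
        Real.logb 2 (1 + N * powerLeft p m / (σ ^ 2 * dimLeft n N m)) := rfl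
  rw [hd, closedFormNat]
  simp only [h, Real.logb]
  rw [add_div, mul_add, Finset.sum_div, Finset.mul_sum]
  congr 1
  · refine Finset.sum_congr rfl fun k _ => ?_
    ring
  · ring

/-- The tangent at `z` of the rate `v log (1 + γ p / v)` as a function of the number `v` of
dimensions and the power `p`; at `v = 0` it also bounds the junk value `0`. -/
lemma mul_log_le {γ v q z : ℝ} (hγ : 0 < γ) (hv : 0 ≤ v) (hq : 0 ≤ q) (hz : 0 ≤ z) :
    v * Real.log (1 + γ * (q / v)) ≤
      v * (Real.log (1 + γ * z) - γ * z / (1 + γ * z)) + γ * q / (1 + γ * z) := by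
  rcases hv.eq_or_lt with rfl | hv
  · simp only [zero_mul, zero_add]
    positivity
  · have h := mul_le_mul_of_nonneg_left
      (log_one_add_le (x := γ * (q / v)) (y := γ * z) (by positivity) (by positivity)) hv.le
    refine h.trans_eq ?_
    have : 0 < 1 + γ * z := by positivity
    field_simp
    ring

/-- The derivative of `v log (1 + γ p / v)` in `v` grows with the power `z = p / v` per dimension. -/
lemma marginal_mono {γ c z : ℝ} (hγ : 0 < γ) (hc : 0 ≤ c) (hcz : c ≤ z) :
    Real.log (1 + γ * c) - γ * c / (1 + γ * c) ≤ Real.log (1 + γ * z) - γ * z / (1 + γ * z) := by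
  have hz := hc.trans hcz
  have h := log_one_add_le (x := γ * c) (y := γ * z) (by positivity) (by positivity)
  have h2 : γ * c / (1 + γ * z) ≤ γ * c / (1 + γ * c) := by gcongr
  rw [sub_div] at h
  linarith

lemma marginal_nonneg {γ c : ℝ} (hγ : 0 < γ) (hc : 0 ≤ c) :
    0 ≤ Real.log (1 + γ * c) - γ * c / (1 + γ * c) := by
  simpa using marginal_mono hγ le_rfl hc

section threshold

variable (h : IsThreshold p n N m) (hp : ∀ k, 0 < p k) (hn : ∀ k, 0 < n k) (hN : 0 < N)
include h hp hn hN

lemma IsThreshold.dimLeft_mul_ratio :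
    dimLeft n N m * (powerLeft p m / dimLeft n N m) = powerLeft p m :=
  mul_div_cancel_of_imp' fun h0 => h.powerLeft_eq_zero hp hn hN h0

/-- Linear programming duality for bandwidth allocation: the tangents at the power levels of the
threshold bound the rate, and the threshold allocation maximizes the bound. -/
lemma fdma_le {γ : ℝ} (hγ : 0 < γ) {v : Fin K → ℝ} (hv : ∀ k, 0 ≤ v k ∧ v k ≤ n k)
    (hs : ∑ k, v k ≤ N) :
    ∑ k, v k * Real.log (1 + γ * (p k / v k)) ≤ closedFormNat p n N m γ := by
  have hn' : ∀ k, (0 : ℝ) < n k := fun k => by exact_mod_cast hn k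
  have hc := h.ratio_nonneg hp
  have hcM := h.dimLeft_mul_ratio hp hn hN
  rw [closedFormNat]
  set c := powerLeft p m / dimLeft n N m with hc_def
  have hc1 : 0 < 1 + γ * c := by positivity
  set φ : ℝ → ℝ := fun z => Real.log (1 + γ * z) - γ * z / (1 + γ * z) with hφ
  have hφc : 0 ≤ φ c := marginal_nonneg hγ hc
  rw [sum_split m] at hs ⊢
  have h1 : ∑ k : Fin K with k.val < m, v k * Real.log (1 + γ * (p k / v k)) ≤
      ∑ k : Fin K with k.val < m,
        (n k * Real.log (1 + γ * (p k / n k)) - n k * φ c + v k * φ c) := by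
    refine Finset.sum_le_sum fun k hk => ?_
    have hz : 0 ≤ p k / n k := (div_pos (hp k) (hn' k)).le
    have hz1 : 0 < 1 + γ * (p k / n k) := by positivity
    have ht := mul_log_le hγ (hv k).1 (hp k).le hz
    have hmono : φ c ≤ φ (p k / n k) :=
      marginal_mono hγ hc (h.ratio_le hp hn (by simpa using hk))
    have hx := mul_nonneg (sub_nonneg.2 (hv k).2) (sub_nonneg.2 hmono)
    have he : n k * φ (p k / n k) + γ * p k / (1 + γ * (p k / n k)) =
        n k * Real.log (1 + γ * (p k / n k)) := by
      have : (n k : ℝ) * (p k / n k) = p k := mul_div_cancel₀ _ (hn' k).ne'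
      have h3 : γ * p k = n k * (γ * (p k / n k)) := by linear_combination -γ * this
      rw [h3]
      simp only [hφ]
      ring
    have ht' : v k * Real.log (1 + γ * (p k / v k)) ≤
      v k * φ (p k / n k) + γ * p k / (1 + γ * (p k / n k)) := ht
    linarith
  have h2 : ∑ k : Fin K with m ≤ k.val, v k * Real.log (1 + γ * (p k / v k)) ≤
      ∑ k : Fin K with m ≤ k.val, (v k * φ c + γ / (1 + γ * c) * p k) := by
    refine Finset.sum_le_sum fun k _ => ?_
    refine (mul_log_le hγ (hv k).1 (hp k).le hc).trans_eq ?_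
    simp only [hφ]
    ring
  simp only [Finset.sum_add_distrib, Finset.sum_sub_distrib, ← Finset.sum_mul,
    ← Finset.mul_sum] at h1 h2
  change _ ≤ _ + γ / (1 + γ * c) * powerLeft p m at h2
  rw [← hcM] at h2
  have h3 := mul_le_mul_of_nonneg_right hs hφc
  have h4 : dimLeft n N m * Real.log (1 + γ * c) =
      dimLeft n N m * φ c + γ / (1 + γ * c) * (dimLeft n N m * c) := by
    simp only [hφ]
    ring
  have h5 : dimLeft n N m * φ c =
      N * φ c - (∑ k : Fin K with k.val < m, (n k : ℝ)) * φ c := by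
    rw [dimLeft, sub_mul]
  linarith

/-- The threshold allocation: full bandwidth for the first `m` users, the rest in proportion to the
powers. -/
lemma exists_fdma_eq (γ : ℝ) : ∃ v : Fin K → ℝ, (∀ k, 0 ≤ v k ∧ v k ≤ n k) ∧
    ∑ k, v k ≤ N ∧ ∑ k, v k * Real.log (1 + γ * (p k / v k)) = closedFormNat p n N m γ := by
  have hM := h.dimLeft_nonneg hp
  have hP := powerLeft_nonneg hp (m := m)
  have hL : ∑ k : Fin K with m ≤ k.val, p k / powerLeft p m * dimLeft n N m ≤
      dimLeft n N m := by
    rw [← Finset.sum_mul, ← Finset.sum_div, ← powerLeft]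
    exact mul_le_of_le_one_left hM (div_self_le_one _)
  have e1 : ∀ f : Fin K → ℝ → ℝ, ∑ k : Fin K with k.val < m,
      f k (if k.val < m then n k else p k / powerLeft p m * dimLeft n N m) =
      ∑ k : Fin K with k.val < m, f k (n k) := fun f =>
    Finset.sum_congr rfl fun k hk => by rw [if_pos (by simpa using hk)]
  have e2 : ∀ f : Fin K → ℝ → ℝ, ∑ k : Fin K with m ≤ k.val,
      f k (if k.val < m then n k else p k / powerLeft p m * dimLeft n N m) =
      ∑ k : Fin K with m ≤ k.val, f k (p k / powerLeft p m * dimLeft n N m) := fun f =>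
    Finset.sum_congr rfl fun k hk => by rw [if_neg (not_lt.2 (by simpa using hk))]
  refine ⟨fun k => if k.val < m then n k else p k / powerLeft p m * dimLeft n N m,
    fun k => ?_, ?_, ?_⟩
  · dsimp only
    split_ifs with hk
    · exact ⟨Nat.cast_nonneg _, le_rfl⟩
    · have hpk := hp k
      rw [not_lt] at hk
      refine ⟨by positivity, ?_⟩
      rw [div_mul_eq_mul_div, div_le_iff₀ (powerLeft_pos hp k hk), mul_comm, mul_comm (n k : ℝ)]
      exact h.le_of_ge k hk
  · rw [sum_split m, e1 fun _ x => x, e2 fun _ x => x]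
    rw [dimLeft] at hL ⊢
    linarith
  · rw [sum_split m, e1 fun k x => x * Real.log (1 + γ * (p k / x)),
      e2 fun k x => x * Real.log (1 + γ * (p k / x)), closedFormNat]
    congr 1
    have : ∀ k ∈ Finset.univ.filter (fun k : Fin K => m ≤ k.val),
        p k / powerLeft p m * dimLeft n N m *
          Real.log (1 + γ * (p k / (p k / powerLeft p m * dimLeft n N m))) =
        p k * (dimLeft n N m / powerLeft p m *
          Real.log (1 + γ * (powerLeft p m / dimLeft n N m))) := by
      intro k hk
      have hk' : m ≤ k.val := by simpa using hk
      have h1 := hp k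
      have h2 := powerLeft_pos hp k hk'
      have h3 := h.dimLeft_pos hp hn hN hk'
      have : p k / (p k / powerLeft p m * dimLeft n N m) = powerLeft p m / dimLeft n N m := by
        field_simp
      rw [this]
      ring
    rw [Finset.sum_congr rfl this, ← Finset.sum_mul, ← powerLeft]
    rcases hP.eq_or_lt with h0 | h0
    · simp [← h0]
    · field_simp

end threshold

lemma fdma_term_eq (hN : 0 < N) (hσ : 0 < σ) (q v : ℝ) :
    v / (2 * N) * Real.logb 2 (1 + q / (2 * σ ^ 2 * (v / (2 * N)))) =
      1 / (2 * (N : ℝ)) * (v * Real.log (1 + N / σ ^ 2 * (q / v)) / Real.log 2) := by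
  have hN' : (N : ℝ) ≠ 0 := by positivity
  have : q / (2 * σ ^ 2 * (v / (2 * N))) = N / σ ^ 2 * (q / v) := by
    rcases eq_or_ne v 0 with rfl | hv
    · simp
    · field_simp
  rw [this, Real.logb]
  ring

/-- At a threshold, the closed form is the maximum sum rate of the restricted FDMA system. -/
lemma isGreatest_fdma (h : IsThreshold p n N m) (hp : ∀ k, 0 < p k) (hn : ∀ k, 0 < n k)
    (hN : 0 < N) (hσ : 0 < σ) :
    IsGreatest (fdmaSumRates p (fun k => (n k : ℝ) / (2 * N)) (1 / 2) (2 * σ ^ 2))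
      (closedForm p n N σ m) := by
  have hN' : (0 : ℝ) < N := by positivity
  have hlog : 0 < Real.log 2 := Real.log_pos one_lt_two
  constructor
  · obtain ⟨v, h1, h2, h3⟩ := exists_fdma_eq h hp hn hN (N / σ ^ 2)
    refine ⟨fun k => v k / (2 * N), fun k => ⟨?_, ?_⟩, ?_, ?_⟩
    · have := (h1 k).1
      positivity
    · exact div_le_div_of_nonneg_right (h1 k).2 (by positivity)
    · rw [← Finset.sum_div, div_le_div_iff₀ (by positivity) two_pos]
      linarith
    · simp only [fdma_term_eq hN hσ]
      rw [← Finset.mul_sum, ← Finset.sum_div, h3, closedForm_eq]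
  · rintro r ⟨w, h1, h2, rfl⟩
    have hw : ∀ k, w k = 2 * N * w k / (2 * N) := fun k => by field_simp
    have hterm : ∀ k, w k * Real.logb 2 (1 + p k / (2 * σ ^ 2 * w k)) =
        1 / (2 * (N : ℝ)) *
          (2 * N * w k * Real.log (1 + N / σ ^ 2 * (p k / (2 * N * w k))) / Real.log 2) := by
      intro k
      rw [← fdma_term_eq hN hσ, ← hw]
    simp only [hterm]
    rw [← Finset.mul_sum, ← Finset.sum_div, closedForm_eq]
    gcongr
    refine fdma_le h hp hn hN (by positivity) (fun k => ⟨?_, ?_⟩) ?_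
    · have := (h1 k).1
      positivity
    · have := (h1 k).2
      rw [le_div_iff₀ (by positivity)] at this
      linarith
    · rw [← Finset.mul_sum]
      have := mul_le_mul_of_nonneg_left h2 hN'.le
      linarith

/-! ### The multi-code CDMA system -/

/-- The streams of the first `m` users. -/
abbrev HeadStream (n : Fin K → ℕ) (m : ℕ) : Type := {j : Stream n // j.1.val < m}

/-- The streams of all but the first `m` users. -/
abbrev TailStream (n : Fin K → ℕ) (m : ℕ) : Type := {j : Stream n // ¬ j.1.val < m}

/-- The eigenvalues, up to the factor `N`, of the optimal `S P Sᵀ`: one dimension of power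
`p k / n k` for each stream of the first `m` users, and `M` dimensions that share the power left. -/
noncomputable def level (p : Fin K → ℝ) (n : Fin K → ℕ) (N m : ℕ) :
    HeadStream n m ⊕ Fin M → ℝ :=
  Sum.elim (fun j => p j.1.1 / n j.1.1) fun _ => powerLeft p m / dimLeft n N m

lemma sum_subtype_stream (Q : Fin K → Prop) [DecidablePred Q] (F : Fin K → ℝ) :
    ∑ j : {j : Stream n // Q j.1}, F j.1.1 = ∑ k with Q k, n k * F k := by
  rw [← Finset.sum_subtype (Finset.univ.filter fun j : Stream n => Q j.1) (by simp)
    (fun j : Stream n => F j.1), Finset.sum_filter, Fintype.sum_sigma, Finset.sum_filter]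
  refine Finset.sum_congr rfl fun k _ => ?_
  split_ifs <;> simp

lemma exists_equiv_headStream (h : 0 ≤ dimLeft n N m) :
    ∃ M : ℕ, (M : ℝ) = dimLeft n N m ∧ Nonempty (Fin N ≃ HeadStream n m ⊕ Fin M) := by
  have hc : (Fintype.card (HeadStream n m) : ℝ) = ∑ k : Fin K with k.val < m, (n k : ℝ) := by
    have := sum_subtype_stream (n := n) (fun k => k.val < m) fun _ => 1
    simpa using this
  have hle : Fintype.card (HeadStream n m) ≤ N := by
    rw [dimLeft, ← hc] at h
    exact_mod_cast sub_nonneg.1 h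
  refine ⟨N - Fintype.card (HeadStream n m), ?_, ⟨Fintype.equivOfCardEq ?_⟩⟩
  · rw [Nat.cast_sub hle, hc, dimLeft]
  · rw [Fintype.card_fin, Fintype.card_sum, Fintype.card_fin]
    omega

lemma sum_level (hM : (M : ℝ) = dimLeft n N m) (e : Fin N ≃ HeadStream n m ⊕ Fin M) (F : ℝ → ℝ) :
    ∑ i, F (level p n N m (e i)) = ∑ k : Fin K with k.val < m, n k * F (p k / n k) +
      dimLeft n N m * F (powerLeft p m / dimLeft n N m) := by
  rw [e.sum_comp fun x => F (level p n N m x), Fintype.sum_sum_type]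
  simp only [level, Sum.elim_inl, Sum.elim_inr, Finset.sum_const, Finset.card_univ,
    Fintype.card_fin, nsmul_eq_mul, hM]
  rw [sum_subtype_stream (fun k => k.val < m) fun k => F (p k / n k)]

lemma closedFormNat_eq_sum (hM : (M : ℝ) = dimLeft n N m) (e : Fin N ≃ HeadStream n m ⊕ Fin M)
    (γ : ℝ) :
    closedFormNat p n N m γ = ∑ i, Real.log (1 + γ * level p n N m (e i)) :=
  (sum_level hM e fun z => Real.log (1 + γ * z)).symm

lemma concat_mul_blockDiagonal'_mul (S : (k : Fin K) → Matrix (Fin N) (Fin (n k)) ℝ)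
    (P : (k : Fin K) → Matrix (Fin (n k)) (Fin (n k)) ℝ) :
    concat S * blockDiagonal' P * (concat S)ᵀ = ∑ k, S k * P k * (S k)ᵀ := by
  have h : concat S * blockDiagonal' P = concat fun k => S k * P k := by
    ext i j
    rw [mul_apply, Fintype.sum_sigma, Finset.sum_eq_single j.1]
    · simp [concat, mul_apply, blockDiagonal'_apply]
    · intro k _ hk
      refine Finset.sum_eq_zero fun l _ => ?_
      rw [blockDiagonal'_apply, dif_neg hk, mul_zero]
    · simp
  rw [h]
  ext i i'
  rw [mul_apply, Fintype.sum_sigma, Matrix.sum_apply]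
  simp [concat, mul_apply]

section upper

variable (h : IsThreshold p n N m) (hp : ∀ k, 0 < p k) (hn : ∀ k, 0 < n k) (hN : 0 < N)
  (hord : ∀ i j : Fin K, i ≤ j → p j / (n j : ℝ) ≤ p i / (n i : ℝ))
include h hp hn hN hord

/-- The bound on the tangent functional: with signal power `a k i` of user `k` along the `i`-th basis
vector of a flag basis, the first `m` users reach only dimensions of at least their own level. -/
lemma sum_div_level_le (hM : (M : ℝ) = dimLeft n N m) (e : Fin N ≃ HeadStream n m ⊕ Fin M)
    {γ : ℝ} (hγ : 0 < γ) (a : Fin K → Fin N → ℝ) (ha : ∀ k i, 0 ≤ a k i)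
    (hsum : ∀ k, ∑ i, a k i = p k)
    (hzero : ∀ k i, k.val < m → k.val < Sum.elim (fun j => j.1.1.val) (fun _ => m) (e i) →
      a k i = 0) :
    ∑ i, (∑ k, a k i) / (1 + γ * level p n N m (e i)) ≤
      ∑ i, level p n N m (e i) / (1 + γ * level p n N m (e i)) := by
  have hn' : ∀ k, (0 : ℝ) < n k := fun k => by exact_mod_cast hn k
  have hc := h.ratio_nonneg hp
  have hcM := h.dimLeft_mul_ratio hp hn hN
  have hlev : ∀ x : HeadStream n m ⊕ Fin M, powerLeft p m / dimLeft n N m ≤ level p n N m x := by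
    rintro (j | r)
    · exact h.ratio_le hp hn j.2
    · exact le_rfl
  rw [sum_level hM e fun z => z / (1 + γ * z)]
  simp only [Finset.sum_div]
  rw [Finset.sum_comm, sum_split m]
  set c := powerLeft p m / dimLeft n N m with hc_def
  refine add_le_add ?_ ?_
  · refine Finset.sum_le_sum fun k hk => ?_
    have hk : k.val < m := by simpa using hk
    have hz : 0 ≤ p k / n k := (div_pos (hp k) (hn' k)).le
    calc _ ≤ ∑ i, a k i / (1 + γ * (p k / n k)) := by
          refine Finset.sum_le_sum fun i _ => ?_
          by_cases hi : k.val < Sum.elim (fun j => j.1.1.val) (fun _ => m) (e i)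
          · simp [hzero k i hk hi]
          · have hle : p k / n k ≤ level p n N m (e i) := by
              rcases hx : e i with j | r
              · rw [hx, Sum.elim_inl, not_lt] at hi
                exact hord _ _ hi
              · rw [hx, Sum.elim_inr] at hi
                exact absurd hk hi
            have := ha k i
            gcongr
      _ = _ := by
          rw [← Finset.sum_div, hsum, ← mul_div_assoc (n k : ℝ) (p k / n k), mul_div_cancel₀ _ (hn' k).ne']
  · calc _ ≤ ∑ k : Fin K with m ≤ k.val, ∑ i, a k i / (1 + γ * c) := by
          refine Finset.sum_le_sum fun k _ => Finset.sum_le_sum fun i _ => ?_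
          have := ha k i
          have := hlev (e i)
          gcongr
      _ = _ := by
          simp only [← Finset.sum_div, hsum]
          change powerLeft p m / _ = _
          rw [← mul_div_assoc (dimLeft n N m) c, hcM]

/-- The converse: no choice of signatures and correlations exceeds the closed form. -/
lemma log_det_le_closedFormNat (hσ : 0 < σ) (S : (k : Fin K) → Matrix (Fin N) (Fin (n k)) ℝ)
    (P : (k : Fin K) → Matrix (Fin (n k)) (Fin (n k)) ℝ) (hP : ∀ k, (P k).PosSemidef)
    (htr : ∀ k, 1 / (N : ℝ) * (S k * P k * (S k).transpose).trace = p k) :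
    Real.log (1 + (1 / σ ^ 2) • (concat S * blockDiagonal' P * (concat S)ᵀ) :
      Matrix (Fin N) (Fin N) ℝ).det ≤ closedFormNat p n N m (N / σ ^ 2) := by
  obtain ⟨M, hM, ⟨e⟩⟩ := exists_equiv_headStream (h.dimLeft_nonneg hp)
  have hN' : (0 : ℝ) < N := by positivity
  set γ : ℝ := N / σ ^ 2 with hγ_def
  have hγ : 0 < γ := by positivity
  -- an orthonormal basis adapted to the flag of the ranges of `[S₁, …, S_k]`, `k ≤ m`
  obtain ⟨b, hb⟩ := exists_orthonormalBasis_of_levels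
    (fun i => Sum.elim (fun j : HeadStream n m => j.1.1.val) (fun _ : Fin M => m) (e i))
    (fun i => WithLp.toLp 2 (Sum.elim (fun (j : HeadStream n m) a => S j.1.1 a j.1.2)
      (fun (_ : Fin M) _ => 0) (e i)))
  let U : Matrix (Fin N) (Fin N) ℝ := of fun i a => b i a
  have hU : U * Uᵀ = 1 := by
    ext i i'
    have := b.inner_eq_ite i' i
    simp only [PiLp.inner_apply, RCLike.inner_apply, conj_trivial] at this
    rw [mul_apply, one_apply]
    simpa [U, eq_comm] using this
  have hU' : Uᵀ * U = 1 := mul_eq_one_comm.1 hU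
  have hT : ∀ k i, k.val < m →
      k.val < Sum.elim (fun j : HeadStream n m => j.1.1.val) (fun _ : Fin M => m) (e i) →
      ∀ l, (U * S k) i l = 0 := by
    intro k i hk hi l
    have := hb i (e.symm (Sum.inl ⟨⟨k, l⟩, hk⟩)) (by simpa using hi)
    simp only [Equiv.apply_symm_apply, Sum.elim_inl, PiLp.inner_apply, RCLike.inner_apply,
      conj_trivial] at this
    rw [mul_apply, ← this]
    exact Finset.sum_congr rfl fun a _ => mul_comm _ _
  have hpsd : ∀ k, (U * S k * P k * (U * S k)ᵀ).PosSemidef := fun k => by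
    simpa [conjTranspose_eq_transpose_of_trivial] using
      (hP k).mul_mul_conjTranspose_same (U * S k)
  have hX : U * (1 + (1 / σ ^ 2) • (concat S * blockDiagonal' P * (concat S)ᵀ)) * Uᵀ =
      1 + (1 / σ ^ 2) • ∑ k, U * S k * P k * (U * S k)ᵀ := by
    rw [concat_mul_blockDiagonal'_mul, Matrix.mul_add, Matrix.add_mul, Matrix.mul_one, hU,
      Matrix.mul_smul, Matrix.smul_mul, Matrix.mul_sum, Matrix.sum_mul]
    simp only [transpose_mul, Matrix.mul_assoc]
  have hXpos : (1 + (1 / σ ^ 2) • ∑ k, U * S k * P k * (U * S k)ᵀ).PosDef :=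
    PosDef.one.add_posSemidef
      ((posSemidef_sum _ fun k _ => hpsd k).smul (by positivity))
  have hdet : (1 + (1 / σ ^ 2) • (concat S * blockDiagonal' P * (concat S)ᵀ) :
      Matrix (Fin N) (Fin N) ℝ).det =
      (1 + (1 / σ ^ 2) • ∑ k, U * S k * P k * (U * S k)ᵀ).det := by
    rw [← hX, det_mul_right_comm, hU, Matrix.one_mul]
  have hlev : ∀ x : HeadStream n m ⊕ Fin M, 0 ≤ level p n N m x := by
    rintro (j | r)
    · exact div_nonneg (hp _).le (Nat.cast_nonneg _)
    · exact h.ratio_nonneg hp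
  have hd : ∀ i, 0 < 1 + γ * level p n N m (e i) := fun i => by
    have := hlev (e i)
    positivity
  rw [hdet, closedFormNat_eq_sum hM e]
  refine (log_det_le hXpos _ hd).trans ?_
  have hkey := sum_div_level_le h hp hn hN hord hM e hγ
    (fun k i => 1 / (N : ℝ) * (U * S k * P k * (U * S k)ᵀ) i i)
    (fun k i => mul_nonneg (by positivity) (hpsd k).diag_nonneg)
    (fun k => by
      rw [← Finset.mul_sum, ← htr k]
      congr 1
      change (U * S k * P k * (U * S k)ᵀ).trace = _
      have : U * S k * P k * (U * S k)ᵀ = U * (S k * P k * (S k)ᵀ) * Uᵀ := by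
        simp only [transpose_mul, Matrix.mul_assoc]
      rw [this, trace_mul_comm, ← Matrix.mul_assoc, hU', Matrix.one_mul])
    (fun k i hk hi => by
      have : (U * S k * P k * (U * S k)ᵀ) i i = 0 := by
        rw [Matrix.mul_assoc, mul_apply]
        exact Finset.sum_eq_zero fun l _ => by rw [hT k i hk hi l, zero_mul]
      rw [this, mul_zero])
  have hterm : ∀ i, (1 + (1 / σ ^ 2) • ∑ k, U * S k * P k * (U * S k)ᵀ :
        Matrix (Fin N) (Fin N) ℝ) i i / (1 + γ * level p n N m (e i)) - 1 =
      γ * ((∑ k, 1 / (N : ℝ) * (U * S k * P k * (U * S k)ᵀ) i i) /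
        (1 + γ * level p n N m (e i))) -
      γ * (level p n N m (e i) / (1 + γ * level p n N m (e i))) := by
    intro i
    have hdi := (hd i).ne'
    rw [Matrix.add_apply, Matrix.smul_apply, one_apply_eq, Matrix.sum_apply, ← Finset.mul_sum, smul_eq_mul,
      hγ_def]
    rw [hγ_def] at hdi
    generalize ∑ k, (U * S k * P k * (U * S k)ᵀ) i i = A
    have h1 : (N : ℝ) / σ ^ 2 * (1 / N * A / (1 + N / σ ^ 2 * level p n N m (e i))) =
        1 / σ ^ 2 * A / (1 + N / σ ^ 2 * level p n N m (e i)) := by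
      rw [← mul_div_assoc]
      congr 1
      field_simp
    rw [h1, ← mul_div_assoc, div_sub_one hdi, ← sub_div]
    congr 1
    ring
  simp only [hterm]
  rw [Finset.sum_add_distrib, Finset.sum_sub_distrib, ← Finset.mul_sum, ← Finset.mul_sum]
  have := mul_le_mul_of_nonneg_left hkey hγ.le
  linarith

end upper

/-- Column norms and orthogonal rows that reach the closed form: the first `m` users have orthogonal
streams, the others share the remaining dimensions as a tight frame. -/
lemma exists_signatures (h : IsThreshold p n N m) (hp : ∀ k, 0 < p k) (hn : ∀ k, 0 < n k)
    (hN : 0 < N) (hM : (M : ℝ) = dimLeft n N m) (e : Fin N ≃ HeadStream n m ⊕ Fin M) :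
    ∃ W : Matrix (Fin N) (Stream n) ℝ, W * Wᵀ = diagonal (fun i => level p n N m (e i)) ∧
      ∀ j, ∑ i, W i j ^ 2 = p j.1 / n j.1 := by
  have hn' : ∀ k, (0 : ℝ) < n k := fun k => by exact_mod_cast hn k
  have hq : ∀ k, 0 ≤ p k / n k := fun k => (div_pos (hp k) (hn' k)).le
  obtain ⟨V, hV, hVcol⟩ := exists_tight_frame M (h.ratio_nonneg hp)
    (fun j : TailStream n m => p j.1.1 / n j.1.1) (fun j => hq _)
    (fun j => h.le_ratio hp hn hN (not_lt.1 j.2)) (by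
      rw [hM, h.dimLeft_mul_ratio hp hn hN,
        sum_subtype_stream (fun k => ¬ k.val < m) fun k => p k / n k, powerLeft]
      simp only [not_lt]
      exact Finset.sum_congr rfl fun k _ => mul_div_cancel₀ _ (hn' k).ne')
  let W₀ : Matrix (HeadStream n m ⊕ Fin M) (HeadStream n m ⊕ TailStream n m) ℝ :=
    fromBlocks (diagonal fun j => √(p j.1.1 / n j.1.1)) 0 0 V
  let e' : HeadStream n m ⊕ TailStream n m ≃ Stream n :=
    Equiv.sumCompl fun j : Stream n => j.1.val < m
  have hW₀ : W₀ * W₀ᵀ = diagonal (level p n N m) := by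
    simp only [W₀, fromBlocks_transpose, fromBlocks_multiply, Matrix.zero_mul, Matrix.mul_zero,
      transpose_zero, add_zero, zero_add, hV, diagonal_transpose, diagonal_mul_diagonal,
      Real.mul_self_sqrt (hq _), fromBlocks_diagonal]
    rfl
  have hcol : ∀ x, ∑ y, W₀ y x ^ 2 = p (e' x).1 / n (e' x).1 := by
    rintro (j | j)
    · simp [W₀, e', diagonal_apply, div_pow, Real.sq_sqrt (hp _).le]
    · simp [W₀, e', hVcol]
  refine ⟨W₀.submatrix e e'.symm, ?_, fun j => ?_⟩
  · rw [transpose_submatrix, submatrix_mul_equiv, hW₀, submatrix_diagonal_equiv]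
    rfl
  · have := hcol (e'.symm j)
    rw [e'.apply_symm_apply] at this
    rw [← this]
    exact e.sum_comp fun y => W₀ y (e'.symm j) ^ 2

/-- The closed form at a threshold is a rate with equal power splits and signatures of squared norm
`N`. -/
lemma closedForm_mem_cdmaSplitSumRates (h : IsThreshold p n N m) (hp : ∀ k, 0 < p k)
    (hn : ∀ k, 0 < n k) (hN : 0 < N) (hσ : 0 < σ) :
    closedForm p n N σ m ∈ cdmaSplitSumRates p n N σ := by
  obtain ⟨M, hM, ⟨e⟩⟩ := exists_equiv_headStream (h.dimLeft_nonneg hp)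
  obtain ⟨W, hW, hcol⟩ := exists_signatures h hp hn hN hM e
  have hn' : ∀ k, (0 : ℝ) < n k := fun k => by exact_mod_cast hn k
  have hq : ∀ k, 0 < p k / n k := fun k => div_pos (hp k) (hn' k)
  have hN' : (0 : ℝ) < N := by positivity
  have hlev : ∀ x : HeadStream n m ⊕ Fin M, 0 ≤ level p n N m x := by
    rintro (j | r)
    · exact (hq _).le
    · exact h.ratio_nonneg hp
  refine ⟨of fun i j => √(N / (p j.1 / n j.1)) * W i j, fun k _ => p k / n k, fun j => ?_,
    fun k _ => (hq k).le, fun k => ?_, ?_⟩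
  · have := hq j.1
    simp only [of_apply, mul_pow]
    rw [← Finset.mul_sum, hcol, Real.sq_sqrt (by positivity), div_mul_cancel₀ _ this.ne']
  · simp [mul_div_cancel₀ _ (hn' k).ne']
  · have hSPS : (of fun i (j : Stream n) => √(N / (p j.1 / n j.1)) * W i j) *
          diagonal (fun j : Stream n => p j.1 / n j.1) *
          (of fun i (j : Stream n) => √(N / (p j.1 / n j.1)) * W i j)ᵀ =
        (N : ℝ) • diagonal fun i => level p n N m (e i) := by
      rw [← hW]
      ext i i'
      rw [mul_apply, Matrix.smul_apply, mul_apply, smul_eq_mul, Finset.mul_sum]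
      refine Finset.sum_congr rfl fun j _ => ?_
      have hj := hq j.1
      have hs : √(N / (p j.1 / n j.1)) ^ 2 * (p j.1 / n j.1) = N := by
        rw [Real.sq_sqrt (by positivity), div_mul_cancel₀ _ hj.ne']
      rw [mul_diagonal, of_apply, transpose_apply, transpose_apply, of_apply]
      linear_combination W i j * W i' j * hs
    have hdiag : (1 + (1 / σ ^ 2) • ((N : ℝ) • diagonal fun i => level p n N m (e i)) :
        Matrix (Fin N) (Fin N) ℝ) = diagonal fun i => 1 + N / σ ^ 2 * level p n N m (e i) := by
      rw [← diagonal_one, smul_smul, ← diagonal_smul, diagonal_add]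
      congr 1
      funext i
      simp only [Pi.smul_apply, smul_eq_mul]
      ring
    rw [sumRate, hSPS, hdiag, det_diagonal, closedForm_eq, closedFormNat_eq_sum hM e, Real.logb,
      Real.log_prod]
    intro i _
    have := hlev (e i)
    positivity

/-- A power split with signatures of squared norm `N` meets the power constraint of the system. -/
lemma cdmaSplitSumRates_subset (hN : 0 < N) :
    cdmaSplitSumRates p n N σ ⊆ cdmaSumRates p n N σ := by
  rintro r ⟨S, q, hS, hq, hs, rfl⟩
  refine ⟨fun k => of fun i l => S i ⟨k, l⟩, fun k => diagonal (q k),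
    fun k => PosSemidef.diagonal (hq k), fun k => ?_, ?_⟩
  · have : ((of fun i l => S i ⟨k, l⟩) * diagonal (q k) * (of fun i l => S i ⟨k, l⟩)ᵀ).trace =
        N * p k := by
      simp only [trace, diag_apply, mul_apply (N := (of fun i l => S i ⟨k, l⟩)ᵀ), mul_diagonal,
        of_apply, transpose_apply]
      rw [Finset.sum_comm, ← hs k, Finset.mul_sum]
      refine Finset.sum_congr rfl fun l _ => ?_
      rw [← hS ⟨k, l⟩, Finset.sum_mul]
      exact Finset.sum_congr rfl fun i _ => by ring
    rw [this]
    field_simp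
  · rw [blockDiagonal'_diagonal]
    rfl

/-- At a threshold, the closed form bounds the sum rates of the CDMA system. -/
lemma le_closedForm (h : IsThreshold p n N m) (hp : ∀ k, 0 < p k) (hn : ∀ k, 0 < n k)
    (hN : 0 < N) (hσ : 0 < σ)
    (hord : ∀ i j : Fin K, i ≤ j → p j / (n j : ℝ) ≤ p i / (n i : ℝ)) {r : ℝ}
    (hr : r ∈ cdmaSumRates p n N σ) : r ≤ closedForm p n N σ m := by
  obtain ⟨S, P, hP, htr, rfl⟩ := hr
  have hlog : 0 < Real.log 2 := Real.log_pos one_lt_two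
  rw [closedForm_eq, sumRate, Real.logb]
  gcongr
  exact log_det_le_closedFormNat h hp hn hN hord hσ S P hP htr

lemma isGreatest_cdma (h : IsThreshold p n N m) (hp : ∀ k, 0 < p k) (hn : ∀ k, 0 < n k)
    (hN : 0 < N) (hσ : 0 < σ)
    (hord : ∀ i j : Fin K, i ≤ j → p j / (n j : ℝ) ≤ p i / (n i : ℝ)) :
    IsGreatest (cdmaSumRates p n N σ) (closedForm p n N σ m) ∧
      IsGreatest (cdmaSplitSumRates p n N σ) (closedForm p n N σ m) :=
  have hmem := closedForm_mem_cdmaSplitSumRates h hp hn hN hσ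
  ⟨⟨cdmaSplitSumRates_subset hN hmem, fun _ => le_closedForm h hp hn hN hσ hord⟩,
    ⟨hmem, fun _ hr => le_closedForm h hp hn hN hσ hord (cdmaSplitSumRates_subset hN hr)⟩⟩

end MultiCodeCDMA

theorem theorem1 {K : ℕ} (p : Fin K → ℝ) (n : Fin K → ℕ) (N : ℕ) (σ : ℝ)
    (hp : ∀ k, 0 < p k) (hn : ∀ k, 0 < n k) (hN : 0 < N) (hσ : 0 < σ)
    (hord : ∀ i j : Fin K, i ≤ j → p j / (n j : ℝ) ≤ p i / (n i : ℝ)) :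
    -- the maximum is attained, also under power splits and signatures of squared norm `N`
    IsGreatest (MultiCodeCDMA.cdmaSumRates p n N σ) (MultiCodeCDMA.cdmaMaxSumRate p n N σ) ∧
    IsGreatest (MultiCodeCDMA.cdmaSplitSumRates p n N σ) (MultiCodeCDMA.cdmaMaxSumRate p n N σ) ∧
    -- it is the maximum sum rate of the restricted FDMA system
    IsGreatest
      (MultiCodeCDMA.fdmaSumRates p (fun k => (n k : ℝ) / (2 * N)) (1 / 2) (2 * σ ^ 2))
      (MultiCodeCDMA.fdmaMaxSumRate p (fun k => (n k : ℝ) / (2 * N)) (1 / 2) (2 * σ ^ 2)) ∧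
    MultiCodeCDMA.cdmaMaxSumRate p n N σ =
      MultiCodeCDMA.fdmaMaxSumRate p (fun k => (n k : ℝ) / (2 * N)) (1 / 2) (2 * σ ^ 2) ∧
    -- the two closed forms
    MultiCodeCDMA.cdmaMaxSumRate p n N σ =
      MultiCodeCDMA.closedForm p n N σ (MultiCodeCDMA.numOversized p n N) ∧
    MultiCodeCDMA.cdmaMaxSumRate p n N σ =
      MultiCodeCDMA.closedForm p n N σ (MultiCodeCDMA.numNonUndersized p n N) := by
  have h₁ := MultiCodeCDMA.isThreshold_numOversized (N := N) hp hn hord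
  have h₂ := MultiCodeCDMA.isThreshold_numNonUndersized (N := N) hp hn hord
  obtain ⟨hc, hsplit⟩ := MultiCodeCDMA.isGreatest_cdma h₁ hp hn hN hσ hord
  have hf := MultiCodeCDMA.isGreatest_fdma h₁ hp hn hN hσ
  have ec : MultiCodeCDMA.cdmaMaxSumRate p n N σ = _ := hc.csSup_eq
  have ef : MultiCodeCDMA.fdmaMaxSumRate p (fun k => (n k : ℝ) / (2 * N)) (1 / 2) (2 * σ ^ 2) = _ :=
    hf.csSup_eq
  have e₂ := (MultiCodeCDMA.isGreatest_cdma h₂ hp hn hN hσ hord).1.unique hc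
  rw [ec, ef]
  exact ⟨hc, hsplit, hf, rfl, rfl, e₂.symm⟩
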